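/- Let $t = 0110100110010110\cdots$ be the Thue–Morse word, i.e. the infinite word whose $n$-th letter ($n \ge 0$) is the parity of the number of ones in the binary expansion of $n$; equivalently, the fixed point beginning with $0$ of the morphism $0 \mapsto 01$, $1 \mapsto 10$. A word $w$ is a complete first return to a word $v$ if $w$ begins and ends with $v$ and contains exactly two occurrences of $v$. The privileged words are defined recursively: the empty word and the letters are privileged, and a word is privileged if it is a complete first return to a shorter privileged word. Let $A(k)$ be the number of privileged words of length $k$ that are factors of $t$ (the privileged complexity function of $t$). Define integers $a_1 = 14$ and $a_n = 4(a_{n-1} - 2) + 2(-1)^n$ for $n \ge 2$. Then for all $n \ge 1$: (i) $A(k) = 0$ for every integer $k$ with $a_n - 1 \le k \le 2^{2(n+1)} + 1$; (ii) $A(a_n - 2) \ne 0$, $A(2^{2n+1} + 2) \ne 0$ and $A(2^{2(n+1)} + 2) \ne 0$. Moreover, there are arbitrarily long, but not infinite, gaps of zeros in the values of $A$: for every $L$ there are $L$ consecutive integers $k$ with $A(k) = 0$, and for every $N$ there is $k \ge N$ with $A(k) \ne 0$. -/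

import Mathlib

/-- `u` occurs in the finite word `w` at position `i` (counted from `0`): `w = z u v` for some
words `z`, `v` with `|z| = i`. -/
def OccursAt {α : Type*} (u w : List α) (i : ℕ) : Prop :=
  ∃ z v : List α, w = z ++ u ++ v ∧ z.length = i

/-- `w` is a complete first return to `u`: it begins and ends with `u` and contains exactly two
occurrences of `u`. -/
def IsCompleteFirstReturn {α : Type*} (u w : List α) : Prop :=
  u <+: w ∧ u <:+ w ∧ {i : ℕ | OccursAt u w i}.ncard = 2

/-- Privileged words: the empty word, the letters, and all complete first returns to shorter
privileged words. -/
inductive IsPrivileged {α : Type*} : List α → Prop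
  | empty : IsPrivileged []
  | letter (a : α) : IsPrivileged [a]
  | completeReturn (v u : List α) (hv : IsPrivileged v) (hlen : v.length < u.length)
      (hret : IsCompleteFirstReturn v u) : IsPrivileged u

/-- The finite word `u` is a factor of the infinite word `w`. -/
def IsFactor {α : Type*} (u : List α) (w : ℕ → α) : Prop :=
  ∃ i : ℕ, u = (List.range u.length).map (fun j => w (i + j))

/-- The set of privileged factors of length `n` of the infinite word `w`. -/
def privilegedFactors {α : Type*} (w : ℕ → α) (n : ℕ) : Set (List α) :=
  {u | IsPrivileged u ∧ IsFactor u w ∧ u.length = n}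

/-- Over a finite alphabet there are only finitely many privileged factors of each length, so that
their number is given by `Set.ncard`. -/
theorem privilegedFactors_finite {α : Type*} [Finite α] (w : ℕ → α) (n : ℕ) :
    (privilegedFactors w n).Finite :=
  (List.finite_length_eq α n).subset fun _ hu => hu.2.2

/-- The privileged complexity function of the infinite word `w`. -/
noncomputable def privilegedComplexity {α : Type*} (w : ℕ → α) (n : ℕ) : ℕ :=
  (privilegedFactors w n).ncard

/-- The Thue-Morse word `0110100110010110⋯`: its `n`-th letter (from `n = 0`) is the parity of the
number of ones in the binary expansion of `n`. -/
def thueMorse (n : ℕ) : Fin 2 :=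
  Fin.ofNat 2 (Nat.digits 2 n).sum

theorem thueMorse_two_mul (n : ℕ) : thueMorse (2 * n) = thueMorse n := by
  rcases Nat.eq_zero_or_pos n with rfl | hn
  · rfl
  · simp [thueMorse, Nat.digits_def' (by norm_num : 1 < 2) (by omega : 0 < 2 * n)]

theorem thueMorse_two_mul_add_one (n : ℕ) : thueMorse (2 * n + 1) = 1 + thueMorse n := by
  have h : (2 * n + 1) / 2 = n := by omega
  apply Fin.ext
  simp [thueMorse, Nat.digits_def' (by norm_num : 1 < 2) (by omega : 0 < 2 * n + 1), h,
    Fin.val_add, Nat.add_mod]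

/-- The Thue-Morse morphism `0 ↦ 01`, `1 ↦ 10`. -/
def thueMorseMorphism (u : List (Fin 2)) : List (Fin 2) :=
  u.flatMap fun a => [a, 1 + a]

/-- The Thue-Morse word is the fixed point, beginning with `0`, of the Thue-Morse morphism: the
image of its prefix of length `n` is its prefix of length `2 * n`. -/
theorem thueMorse_fixedPoint :
    thueMorse 0 = 0 ∧ ∀ n : ℕ, thueMorseMorphism ((List.range n).map thueMorse) =
      (List.range (2 * n)).map thueMorse := by
  refine ⟨by simp [thueMorse], fun n => ?_⟩
  induction n with
  | zero => rfl
  | succ n ih =>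
    have h : 2 * (n + 1) = 2 * n + 1 + 1 := by ring
    rw [h, List.range_succ, List.range_succ, List.range_succ]
    simp only [List.map_append, ← ih]
    simp [thueMorseMorphism, thueMorse_two_mul, thueMorse_two_mul_add_one]

/-- The sequence `a₁ = 14`, `aₙ = 4 (aₙ₋₁ - 2) + 2 (-1)ⁿ` for `n ≥ 2`; the index `0` is not
used. -/
def gapSeq : ℕ → ℤ
  | 0 => 0
  | 1 => 14
  | n + 2 => 4 * (gapSeq (n + 1) - 2) + 2 * (-1) ^ (n + 2)

/-!
The proof works with positions in the Thue-Morse word `t` instead of words. The complete first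
returns of a factor of length `l` at position `p` are read off from `t` itself: if `d` is the
distance from `p` to the next occurrence, then the factor of length `l + d` at `p` is a complete
first return to the factor of length `l` (`isReturn_iff_isCompleteFirstReturn`). Hence a nonempty
factor at `p` is privileged iff its length is reached from `1` by iterating `l ↦ l + d`, that is,
by a `ReturnChain` (`IsPrivileged.returnChain`, `ReturnChain.isPrivileged`).

After one return a letter has become a square `xx`, an alternating word `xyx`, or a word `xyyx`. As
`t` has no cubes, the chains through `xyyx` are those from the inner square `yy`, with one letter
added at either end (`returnChain_pad`). So the lengths of privileged factors are `0`, `1`, the set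
`S` of lengths reached from squares, the set `T` of lengths reached from alternating words, and
`S + 2` (`exists_returnChain_one_iff`).

The sets `S` and `T` satisfy a recursion. The first return to `xx` or `xyx` is a word which occurs
in `t` in one residue class modulo `4` only, so all its occurrences are obtained from the square of
the Thue-Morse morphism by trimming the images of the occurrences of a shorter word, and the whole
chain desubstitutes with it (`returnChain_trim`). The eight possible first returns give
`S = {2} ∪ (4S - 2) ∪ 4S ∪ (4T - 2)` and
`T = {3} ∪ (4T - 6) ∪ (4T - 4) ∪ (4S + 4) ∪ (4S + 2)`
(`mem_squareLengths_iff`, `mem_alternatingLengths_iff`).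

The rest is arithmetic with this recursion. For the gap at level `n` the largest elements of `S` and
`T` below it, and the first candidates above it, are followed through the recursion
(`lengths_le_of_lt`). The element that ends up largest lies in `T` for odd `n` and in `S` for even
`n` (`exists_length_eq_gapSeq_sub`); this alternation is the source of the term `2 (-1) ^ n` in
`gapSeq`.
-/

/-! ### Local structure of the Thue-Morse word -/

theorem thueMorse_zero : thueMorse 0 = 0 := by simp [thueMorse]

theorem thueMorse_one : thueMorse 1 = 1 := by
  simpa [thueMorse_zero] using thueMorse_two_mul_add_one 0

theorem thueMorse_two : thueMorse 2 = 1 := by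
  simpa [thueMorse_one] using thueMorse_two_mul 1

theorem thueMorse_three : thueMorse 3 = 0 := by
  simpa [thueMorse_one] using thueMorse_two_mul_add_one 1

/-- The square of the Thue-Morse morphism: the block of length `4` at `4 * k` is `0110` or its
complement, according to the letter at `k`. The offset `n` may run past the block, so that one
`simp` step evaluates every letter of a short window in terms of the letters of the preimage. -/
theorem thueMorse_four_mul_add (k n : ℕ) :
    thueMorse (4 * k + n) = thueMorse (k + n / 4) + thueMorse (n % 4) := by
  have hn : 4 * k + n = 4 * (k + n / 4) + n % 4 := by omega
  rw [hn]
  have h4 : n % 4 < 4 := Nat.mod_lt _ (by norm_num)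
  generalize k + n / 4 = m
  generalize n % 4 = r at h4
  have e0 : thueMorse (4 * m) = thueMorse m := by
    rw [show 4 * m = 2 * (2 * m) by ring, thueMorse_two_mul, thueMorse_two_mul]
  have e1 : thueMorse (4 * m + 1) = 1 + thueMorse m := by
    rw [show 4 * m + 1 = 2 * (2 * m) + 1 by ring, thueMorse_two_mul_add_one, thueMorse_two_mul]
  have e2 : thueMorse (4 * m + 2) = 1 + thueMorse m := by
    rw [show 4 * m + 2 = 2 * (2 * m + 1) by ring, thueMorse_two_mul, thueMorse_two_mul_add_one]
  have e3 : thueMorse (4 * m + 3) = thueMorse m := by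
    rw [show 4 * m + 3 = 2 * (2 * m + 1) + 1 by ring, thueMorse_two_mul_add_one,
      thueMorse_two_mul_add_one]
    generalize thueMorse m = x
    revert x
    decide
  interval_cases r
  · simp [thueMorse_zero, e0]
  · rw [e1, thueMorse_one, add_comm]
  · rw [e2, thueMorse_two, add_comm]
  · rw [e3, thueMorse_three, add_zero]

theorem odd_of_thueMorse_eq_succ {p : ℕ} (h : thueMorse p = thueMorse (p + 1)) : p % 2 = 1 := by
  by_contra hp
  obtain ⟨m, rfl⟩ : ∃ m, p = 2 * m := ⟨p / 2, by omega⟩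
  rw [thueMorse_two_mul, thueMorse_two_mul_add_one] at h
  generalize thueMorse m = x at h
  revert x
  decide

theorem thueMorse_not_cube (p : ℕ) :
    ¬(thueMorse p = thueMorse (p + 1) ∧ thueMorse (p + 1) = thueMorse (p + 2)) := by
  rintro ⟨h₁, h₂⟩
  have := odd_of_thueMorse_eq_succ h₁
  have := odd_of_thueMorse_eq_succ (p := p + 1) h₂
  omega

/-! ### Chains of complete first returns -/

/-- The factors of length `l` of the Thue-Morse word at the positions `p` and `q` are equal. -/
def FactorEq (l p q : ℕ) : Prop :=
  ∀ i < l, thueMorse (p + i) = thueMorse (q + i)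

/-- `p + d` is the first position after `p` at which the factor of length `l` at `p` occurs again.
-/
def IsReturn (p l d : ℕ) : Prop :=
  0 < d ∧ FactorEq l p (p + d) ∧ ∀ e, 0 < e → e < d → ¬FactorEq l p (p + e)

/-- The factor of length `l` at `p` is reached from the factor of length `l₀` at `p` by iterated
complete first returns. All members of such a chain are prefixes of the last one, so the position
`p` stays fixed and only the length is recorded. -/
inductive ReturnChain (p l₀ : ℕ) : ℕ → Prop
  | refl : ReturnChain p l₀ l₀
  | step {l d : ℕ} (h : ReturnChain p l₀ l) (hd : IsReturn p l d) : ReturnChain p l₀ (l + d)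

theorem FactorEq.mono {l l' p q : ℕ} (h : FactorEq l p q) (hl : l' ≤ l) : FactorEq l' p q :=
  fun i hi => h i (hi.trans_le hl)

theorem IsReturn.unique {p l d d' : ℕ} (h : IsReturn p l d) (h' : IsReturn p l d') : d = d' := by
  rcases lt_trichotomy d d' with hlt | rfl | hlt
  · exact absurd h.2.1 (h'.2.2 d h.1 hlt)
  · rfl
  · exact absurd h'.2.1 (h.2.2 d' h'.1 hlt)

theorem ReturnChain.le {p l₀ l : ℕ} (h : ReturnChain p l₀ l) : l₀ ≤ l := by
  induction h with
  | refl => exact le_rfl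
  | step _ _ ih => omega

/-- Every member of a chain ends with the word from which the chain starts. -/
theorem ReturnChain.suffix {p l₀ l : ℕ} (h : ReturnChain p l₀ l) :
    FactorEq l₀ p (p + (l - l₀)) := by
  induction h with
  | refl => simp [FactorEq]
  | @step l d h hd ih =>
    intro i hi
    have hle := h.le
    rw [ih i hi, add_assoc, hd.2.1 (l - l₀ + i) (by omega)]
    congr 1
    omega

theorem ReturnChain.head {p l₀ d l : ℕ} (hd : IsReturn p l₀ d) (h : ReturnChain p (l₀ + d) l) :
    ReturnChain p l₀ l := by
  induction h with
  | refl => exact .step .refl hd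
  | step _ hd' ih => exact ih.step hd'

theorem ReturnChain.eq_or_exists {p l₀ l : ℕ} (h : ReturnChain p l₀ l) :
    l = l₀ ∨ ∃ d, IsReturn p l₀ d ∧ ReturnChain p (l₀ + d) l := by
  induction h with
  | refl => exact .inl rfl
  | @step l d h hd ih =>
    rcases ih with rfl | ⟨d', hd', h'⟩
    · exact .inr ⟨d, hd, .refl⟩
    · exact .inr ⟨d', hd', h'.step hd⟩

/-- Chains at `p` and at `P` correspond if the occurrences of the words at `P` are the images of the
occurrences of the words at `p` under `p + d ↦ P + c * d`, where the lengths are related by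
`L = c * l + b - a`. It is enough to know this along the chain at `p`. -/
theorem returnChain_transport {P p L₀ l₀ c a b : ℕ} (hc : 0 < c) (h₀ : L₀ + a = c * l₀ + b)
    (H : ∀ l L, ReturnChain p l₀ l → L + a = c * l + b → ∀ D,
      FactorEq L P (P + D) ↔ ∃ d, D = c * d ∧ FactorEq l p (p + d)) {L : ℕ} :
    ReturnChain P L₀ L ↔ ∃ l, L + a = c * l + b ∧ ReturnChain p l₀ l := by
  have hret : ∀ l L, ReturnChain p l₀ l → L + a = c * l + b → ∀ d,
      IsReturn P L (c * d) ↔ IsReturn p l d := by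
    intro l L hl hL d
    have key : ∀ d, FactorEq L P (P + c * d) ↔ FactorEq l p (p + d) := by
      intro d
      rw [H l L hl hL]
      constructor
      · rintro ⟨d', hd', h⟩
        rwa [Nat.eq_of_mul_eq_mul_left hc hd']
      · exact fun h => ⟨d, rfl, h⟩
    constructor
    · rintro ⟨h1, h2, h3⟩
      refine ⟨Nat.pos_of_mul_pos_left h1, (key d).1 h2, fun e he hed h => ?_⟩
      exact h3 (c * e) (Nat.mul_pos hc he) (Nat.mul_lt_mul_of_pos_left hed hc) ((key e).2 h)
    · rintro ⟨h1, h2, h3⟩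
      refine ⟨Nat.mul_pos hc h1, (key d).2 h2, fun E hE hEd h => ?_⟩
      obtain ⟨e, rfl, he⟩ := (H l L hl hL E).1 h
      exact h3 e (Nat.pos_of_mul_pos_left hE) (Nat.lt_of_mul_lt_mul_left hEd) he
  constructor
  · intro h
    induction h with
    | refl => exact ⟨l₀, h₀, .refl⟩
    | @step L D h hD ih =>
      obtain ⟨l, hL, hl⟩ := ih
      obtain ⟨d, rfl, -⟩ := (H l L hl hL D).1 hD.2.1
      exact ⟨l + d, by rw [mul_add]; omega, hl.step ((hret l L hl hL d).1 hD)⟩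
  · rintro ⟨l, hL, hl⟩
    induction hl generalizing L with
    | refl => rw [show L = L₀ by omega]; exact .refl
    | @step l d h hd ih =>
      have hle : l₀ ≤ l := h.le
      have hle' : c * l₀ ≤ c * l := Nat.mul_le_mul_left c hle
      obtain ⟨L', hL'⟩ : ∃ L', L' + a = c * l + b := ⟨c * l + b - a, by omega⟩
      rw [show L = L' + c * d by rw [mul_add] at hL; omega]
      exact (ih hL').step ((hret l L' h hL' d).2 hd)

/-! ### Desubstitution -/

/-- Two factors agree iff their images under the square of the morphism agree after `s` letters at
the beginning and `e` letters at the end have been removed: at most three letters of a block are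
lost, and each letter of a block determines the block. -/
theorem factorEq_trim_iff {l L p q s e : ℕ} (hs : s ≤ 3) (he : e ≤ 3) (hl : 2 ≤ l)
    (hL : L + (s + e) = 4 * l) :
    FactorEq L (4 * p + s) (4 * q + s) ↔ FactorEq l p q := by
  constructor
  · intro h i hi
    -- a letter of the `i`-th block that survives the trimming
    obtain ⟨j, hj, hsj, hjL⟩ : ∃ j, j < 4 ∧ s ≤ 4 * i + j ∧ 4 * i + j - s < L := by
      rcases Nat.eq_zero_or_pos i with rfl | hi0
      · exact ⟨3, by omega, by omega, by omega⟩
      · exact ⟨0, by omega, by omega, by omega⟩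
    have := h _ hjL
    rw [show 4 * p + s + (4 * i + j - s) = 4 * p + (4 * i + j) by omega,
      show 4 * q + s + (4 * i + j - s) = 4 * q + (4 * i + j) by omega,
      thueMorse_four_mul_add, thueMorse_four_mul_add, show (4 * i + j) / 4 = i by omega] at this
    exact add_right_cancel this
  · intro h i hi
    rw [add_assoc, add_assoc, thueMorse_four_mul_add, thueMorse_four_mul_add,
      h ((s + i) / 4) (by omega)]

/-- Desubstitution of chains: if the trimmed image of the initial word occurs in a single residue
class modulo `4`, then the chains starting from it are the trimmed images of the chains from the
initial word. -/
theorem returnChain_trim {p l₀ L₀ s e : ℕ} (hs : s ≤ 3) (he : e ≤ 3) (hl₀ : 2 ≤ l₀)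
    (hL₀ : L₀ + (s + e) = 4 * l₀)
    (sync : ∀ Q, FactorEq L₀ (4 * p + s) Q → Q % 4 = s) {L : ℕ} :
    ReturnChain (4 * p + s) L₀ L ↔ ∃ l, L + (s + e) = 4 * l ∧ ReturnChain p l₀ l := by
  refine returnChain_transport (b := 0) (by norm_num) hL₀ fun l L hl hL D => ?_
  have hle := hl.le
  constructor
  · intro h
    have hD := sync _ (h.mono (by omega))
    refine ⟨D / 4, by omega, (factorEq_trim_iff hs he (by omega) hL).1 ?_⟩
    rwa [show 4 * (p + D / 4) + s = 4 * p + s + D by omega]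
  · rintro ⟨d, rfl, h⟩
    rw [show 4 * p + s + 4 * d = 4 * (p + d) + s by omega]
    exact (factorEq_trim_iff hs he (by omega) hL).2 h

/-! ### Squares and alternating words -/

theorem thueMorse_eq_of_ne_of_ne {i j k : ℕ} (h : thueMorse i ≠ thueMorse k)
    (h' : thueMorse j ≠ thueMorse k) : thueMorse i = thueMorse j := by
  revert h h'
  generalize thueMorse i = x
  generalize thueMorse j = y
  generalize thueMorse k = z
  revert x y z
  decide

/-- The two letters at `p` form a square `xx`. -/
def IsSquareAt (p : ℕ) : Prop := thueMorse p = thueMorse (p + 1)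

/-- The three letters at `p` form an alternating word `xyx`. By definition this says that no square
starts at `p` or at `p + 1`. -/
def IsAlternatingAt (p : ℕ) : Prop :=
  thueMorse p ≠ thueMorse (p + 1) ∧ thueMorse (p + 1) ≠ thueMorse (p + 2)

/-- A square is preceded and followed by the opposite letter, since there are no cubes. As every
word in a chain from a square begins and ends with that square, adding `a ≤ 1` letters in front and
`b ≤ 1` letters behind does not change its occurrences. -/
theorem returnChain_pad {p a b : ℕ} (ha : a ≤ 1) (hb : b ≤ 1) (hp : IsSquareAt (p + a)) {L : ℕ} :
    ReturnChain p (2 + (a + b)) L ↔ ∃ l, L = l + (a + b) ∧ ReturnChain (p + a) 2 l := by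
  have key := returnChain_transport (P := p) (p := p + a) (L₀ := 2 + (a + b)) (l₀ := 2) (c := 1)
    (a := 0) (b := a + b) one_pos (by ring) (L := L) ?_
  · simpa using key
  intro l L hl hL D
  have hle := hl.le
  have hsuf := hl.suffix
  obtain rfl : L = l + (a + b) := by omega
  constructor
  · intro h
    refine ⟨D, by ring, fun i hi => ?_⟩
    have := h (a + i) (by omega)
    rwa [show p + (a + i) = p + a + i by ring, show p + D + (a + i) = p + a + D + i by ring] at this
  · rintro ⟨d, hd, h⟩ i hi
    obtain rfl : D = d := by omega
    rcases Nat.lt_or_ge i a with hia | hia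
    · -- the letter in front of a square differs from the letters of the square
      obtain rfl : a = 1 := by omega
      obtain rfl : i = 0 := by omega
      have h0 := h 0 (by omega)
      have h1 := h 1 (by omega)
      have hp' : thueMorse (p + 1) = thueMorse (p + 1 + 1) := hp
      have c1 := thueMorse_not_cube p
      have c2 := thueMorse_not_cube (p + D)
      have e : p + 1 + D = p + D + 1 := by ring
      rw [e] at h0 h1
      simp only [add_zero, add_assoc, Nat.reduceAdd] at *
      refine thueMorse_eq_of_ne_of_ne (k := p + 1) (fun h => c1 ⟨h, hp'⟩) fun h => c2 ⟨?_, ?_⟩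
      · rw [h, h0]
      · rw [← h0, ← h1, hp']
    rcases Nat.lt_or_ge i (a + l) with hil | hil
    · have := h (i - a) (by omega)
      rwa [show p + a + (i - a) = p + i by omega,
        show p + a + D + (i - a) = p + D + i by omega] at this
    · -- the letter behind the final square, which starts at `p + a + (l - 2)` by `hsuf`
      obtain rfl : b = 1 := by omega
      obtain rfl : i = a + l := by omega
      have h0 := h (l - 2) (by omega)
      have h1 := h (l - 1) (by omega)
      have s0 := hsuf 0 (by omega)
      have s1 := hsuf 1 (by omega)
      have hp' : thueMorse (p + a) = thueMorse (p + a + 1) := hp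
      have c1 := thueMorse_not_cube (p + a + (l - 2))
      have c2 := thueMorse_not_cube (p + a + D + (l - 2))
      rw [show p + a + (l - 2) + 1 = p + a + (l - 1) by omega,
        show p + a + (l - 2) + 2 = p + (a + l) by omega] at c1
      rw [show p + a + D + (l - 2) + 1 = p + a + D + (l - 1) by omega,
        show p + a + D + (l - 2) + 2 = p + D + (a + l) by omega] at c2
      rw [add_zero, add_zero] at s0
      rw [show p + a + (l - 2) + 1 = p + a + (l - 1) by omega] at s1
      have e := (s0.symm.trans hp').trans s1
      have e' := (h0.symm.trans e).trans h1
      refine thueMorse_eq_of_ne_of_ne (k := p + a + (l - 1)) (fun h => c1 ⟨e, h.symm⟩)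
        fun h => c2 ⟨e', h1.symm.trans h.symm⟩

/-! ### Synchronization modulo four -/

theorem IsSquareAt.of_factorEq {l P Q i : ℕ} (hs : IsSquareAt (P + i)) (h : FactorEq l P Q)
    (hi : i + 1 < l) : IsSquareAt (Q + i) := by
  have h0 := h i (by omega)
  have h1 := h (i + 1) hi
  exact (h0.symm.trans hs).trans h1

theorem IsAlternatingAt.of_factorEq {l P Q i : ℕ} (hs : IsAlternatingAt (P + i))
    (h : FactorEq l P Q) (hi : i + 2 < l) : IsAlternatingAt (Q + i) := by
  have h0 := h i (by omega)
  have h1 := h (i + 1) (by omega)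
  have h2 := h (i + 2) hi
  simp only [IsAlternatingAt, add_assoc] at hs ⊢
  rwa [← h0, ← h1, ← h2]

theorem IsAlternatingAt.mod_four {p : ℕ} (h : IsAlternatingAt p) : p % 4 = 2 ∨ p % 4 = 3 := by
  obtain ⟨k, r, hr, rfl⟩ : ∃ k r, r < 4 ∧ p = 4 * k + r := ⟨p / 4, p % 4, by omega, by omega⟩
  interval_cases r <;>
    simp [IsAlternatingAt, add_assoc, thueMorse_four_mul_add, thueMorse_one,
      thueMorse_two, thueMorse_three] at h <;> omega

/-- Squares occur at odd positions, so `xxyyxx` covers the three boundaries between four consecutive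
images of letters under the morphism; these four letters alternate, which fixes their position
modulo `4`. -/
theorem mod_four_eq_one_of_squares {p : ℕ} (h₀ : IsSquareAt p) (h₂ : IsSquareAt (p + 2))
    (h₄ : IsSquareAt (p + 4)) : p % 4 = 1 := by
  have hp := odd_of_thueMorse_eq_succ h₀
  obtain ⟨j, rfl⟩ : ∃ j, p = 2 * j + 1 := ⟨p / 2, by omega⟩
  have key : ∀ i, IsSquareAt (2 * i + 1) → thueMorse i ≠ thueMorse (i + 1) := by
    intro i hi
    rw [IsSquareAt, thueMorse_two_mul_add_one, show 2 * i + 1 + 1 = 2 * (i + 1) by ring,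
      thueMorse_two_mul] at hi
    rw [← hi]
    generalize thueMorse i = x
    revert x
    decide
  have a := IsAlternatingAt.mod_four ⟨key j h₀, key (j + 1) h₂⟩
  have b := IsAlternatingAt.mod_four ⟨key (j + 1) h₂, key (j + 2) h₄⟩
  omega

/-- Synchronization: a factor containing a square and an alternating word occurs in one residue
class modulo `4` only, since the square fixes the parity and the alternating word leaves two
adjacent residues. -/
theorem FactorEq.mod_four_eq {l P Q i j : ℕ} (h : FactorEq l P Q) (hi : i + 2 < l)
    (hPi : IsAlternatingAt (P + i)) (hj : j + 1 < l) (hPj : IsSquareAt (P + j)) :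
    Q % 4 = P % 4 := by
  have h₁ := odd_of_thueMorse_eq_succ hPj
  have h₂ := odd_of_thueMorse_eq_succ (hPj.of_factorEq h hj)
  have h₃ := hPi.mod_four
  have h₄ := (hPi.of_factorEq h hi).mod_four
  omega

/-! ### First returns to squares and alternating words -/

/-- A form of `IsReturn` that can be expanded letter by letter for given `l` and `d`. -/
theorem isReturn_iff_fin {p l d : ℕ} : IsReturn p l d ↔ 0 < d ∧
    (∀ i : Fin l, thueMorse (p + i) = thueMorse (p + d + i)) ∧
    ∀ e : Fin d, 0 < e.1 → ¬∀ i : Fin l, thueMorse (p + i) = thueMorse (p + e + i) := by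
  simp only [IsReturn, FactorEq, Fin.forall_iff]
  exact and_congr_right fun _ => and_congr_right fun _ =>
    forall_congr' fun e => ⟨fun h a b => h b a, fun h a b => h b a⟩

/-- The two first returns to `xx` that desubstitute to a square at `m`. For both, the letters of the
window are expressed by those of the preimage, and the finitely many cases are checked. -/
theorem isReturn_of_square {m : ℕ} (h : IsSquareAt m) :
    IsReturn (4 * m + 1) 2 4 ∧ IsReturn (4 * m + 3) 2 6 := by
  have hc := thueMorse_not_cube m
  simp only [isReturn_iff_fin, IsSquareAt, Fin.forall_fin_succ, Fin.forall_fin_zero] at h ⊢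
  simp [add_assoc, thueMorse_four_mul_add, thueMorse_zero, thueMorse_one, thueMorse_two,
    thueMorse_three] at h hc ⊢
  generalize thueMorse m = a at *
  generalize thueMorse (m + 1) = b at *
  generalize thueMorse (m + 2) = c at *
  revert a b c
  decide

/-- The first returns, one to `xx` and two to `xyx`, that desubstitute to a square preceded by a
letter at `m`. -/
theorem isReturn_of_square_succ {m : ℕ} (h : IsSquareAt (m + 1)) :
    IsReturn (4 * m + 1) 2 6 ∧ IsReturn (4 * m + 2) 3 9 ∧ IsReturn (4 * m + 3) 3 7 := by
  have hc := thueMorse_not_cube m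
  have hc' := thueMorse_not_cube (m + 1)
  simp only [isReturn_iff_fin, IsSquareAt, Fin.forall_fin_succ, Fin.forall_fin_zero] at h ⊢
  simp [add_assoc, thueMorse_four_mul_add, thueMorse_zero, thueMorse_one, thueMorse_two,
    thueMorse_three] at h hc hc' ⊢
  generalize thueMorse m = a at *
  generalize thueMorse (m + 1) = b at *
  generalize thueMorse (m + 2) = c at *
  generalize thueMorse (m + 3) = d at *
  refine ⟨?_, ?_, ?_⟩ <;> decide +revert

/-- The first returns, one to `xx` and two to `xyx`, that desubstitute to an alternating word. -/
theorem isReturn_of_alternating {m : ℕ} (h : IsAlternatingAt m) :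
    IsReturn (4 * m + 1) 2 8 ∧ IsReturn (4 * m + 3) 3 3 ∧ IsReturn (4 * m + 2) 3 5 := by
  simp only [isReturn_iff_fin, IsAlternatingAt, Fin.forall_fin_succ, Fin.forall_fin_zero] at h ⊢
  simp [add_assoc, thueMorse_four_mul_add, thueMorse_zero, thueMorse_one, thueMorse_two,
    thueMorse_three] at h ⊢
  generalize thueMorse m = a at *
  generalize thueMorse (m + 1) = b at *
  generalize thueMorse (m + 2) = c at *
  revert a b c
  decide

theorem isSquareAt_four_mul_add_one (m : ℕ) : IsSquareAt (4 * m + 1) := by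
  simp [IsSquareAt, add_assoc, thueMorse_four_mul_add, thueMorse_one, thueMorse_two]

theorem isSquareAt_four_mul_add_three {m : ℕ} : IsSquareAt (4 * m + 3) ↔ IsSquareAt m := by
  simp [IsSquareAt, add_assoc, thueMorse_four_mul_add, thueMorse_zero, thueMorse_three]

theorem isAlternatingAt_four_mul_add_two {m : ℕ} :
    IsAlternatingAt (4 * m + 2) ↔ ¬IsSquareAt m := by
  simp [IsSquareAt, IsAlternatingAt, add_assoc, thueMorse_four_mul_add, thueMorse_zero,
    thueMorse_two, thueMorse_three]

theorem isAlternatingAt_four_mul_add_three {m : ℕ} :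
    IsAlternatingAt (4 * m + 3) ↔ ¬IsSquareAt m := by
  simp [IsSquareAt, IsAlternatingAt, add_assoc, thueMorse_four_mul_add, thueMorse_zero,
    thueMorse_one, thueMorse_three]

theorem IsSquareAt.not_succ {m : ℕ} (h : IsSquareAt m) : ¬IsSquareAt (m + 1) :=
  fun h' => thueMorse_not_cube m ⟨h, h'⟩

theorem IsSquareAt.not_of_succ {m : ℕ} (h : IsSquareAt (m + 1)) : ¬IsSquareAt m :=
  fun h' => h'.not_succ h

/-! ### Desubstitution of the first returns -/

/-- The word `xxyyxx` at `4 * m + 1` is the image of a square with one letter removed at either end.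
-/
theorem returnChain_six_of_square {m L : ℕ} (h : IsSquareAt m) :
    ReturnChain (4 * m + 1) 6 L ↔ ∃ l, L + 2 = 4 * l ∧ ReturnChain m 2 l := by
  refine returnChain_trim (s := 1) (e := 1) (by norm_num) (by norm_num) le_rfl rfl fun Q hQ => ?_
  have hP : IsSquareAt (4 * m + 1 + 0) ∧ IsSquareAt (4 * m + 1 + 2) ∧
      IsSquareAt (4 * m + 1 + 4) :=
    ⟨isSquareAt_four_mul_add_one m, isSquareAt_four_mul_add_three.2 h,
      isSquareAt_four_mul_add_one (m + 1)⟩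
  exact mod_four_eq_one_of_squares (hP.1.of_factorEq hQ (by norm_num))
    (hP.2.1.of_factorEq hQ (by norm_num)) (hP.2.2.of_factorEq hQ (by norm_num))

/-- The word `xxyxyyxyxx` is the image of an alternating word with one letter removed at either end.
-/
theorem returnChain_ten_of_alternating {m L : ℕ} (h : IsAlternatingAt m) :
    ReturnChain (4 * m + 1) 10 L ↔ ∃ l, L + 2 = 4 * l ∧ ReturnChain m 3 l := by
  refine returnChain_trim (s := 1) (e := 1) (by norm_num) (by norm_num) (by norm_num) rfl
    fun Q hQ => ?_
  have := hQ.mod_four_eq (i := 1) (j := 0) (by norm_num)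
    (isAlternatingAt_four_mul_add_two.2 h.1) (by norm_num)
    (isSquareAt_four_mul_add_one m)
  omega

/-- The word `xyxxyx` is the image of an alternating word with three letters removed at either end.
-/
theorem returnChain_six_of_alternating {m L : ℕ} (h : IsAlternatingAt m) :
    ReturnChain (4 * m + 3) 6 L ↔ ∃ l, L + 6 = 4 * l ∧ ReturnChain m 3 l := by
  refine returnChain_trim (s := 3) (e := 3) (by norm_num) (by norm_num) (by norm_num) rfl
    fun Q hQ => ?_
  have := hQ.mod_four_eq (i := 0) (j := 2) (by norm_num)
    (isAlternatingAt_four_mul_add_three.2 h.1) (by norm_num)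
    (isSquareAt_four_mul_add_one (m + 1))
  omega

/-- The word `xyxyyxyx` is the image of an alternating word with two letters removed at either end.
-/
theorem returnChain_eight_of_alternating {m L : ℕ} (h : IsAlternatingAt m) :
    ReturnChain (4 * m + 2) 8 L ↔ ∃ l, L + 4 = 4 * l ∧ ReturnChain m 3 l := by
  refine returnChain_trim (s := 2) (e := 2) (by norm_num) (by norm_num) (by norm_num) rfl
    fun Q hQ => ?_
  have := hQ.mod_four_eq (i := 0) (j := 3) (by norm_num)
    (isAlternatingAt_four_mul_add_two.2 h.1) (by norm_num)
    (isSquareAt_four_mul_add_one (m + 1))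
  omega

/-- The word `xxyyxyxx` is a trimmed image of a square together with the letter behind it. -/
theorem returnChain_eight_of_square {m L : ℕ} (h : IsSquareAt m) :
    ReturnChain (4 * m + 3) 8 L ↔ ∃ l, L = 4 * l ∧ ReturnChain m 2 l := by
  rw [returnChain_trim (s := 3) (e := 1) (l₀ := 3) (by norm_num) (by norm_num) (by norm_num) rfl]
  · constructor
    · rintro ⟨k, hk, hk'⟩
      obtain ⟨l, hl, hl'⟩ := (returnChain_pad (a := 0) (b := 1) (by norm_num) le_rfl h).1 hk'
      exact ⟨l, by omega, hl'⟩
    · rintro ⟨l, hl, hl'⟩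
      exact ⟨l + 1, by omega, (returnChain_pad (a := 0) (b := 1) (by norm_num) le_rfl h).2
        ⟨l, rfl, hl'⟩⟩
  intro Q hQ
  have := hQ.mod_four_eq (i := 3) (j := 0) (by norm_num)
    (isAlternatingAt_four_mul_add_two.2 h.not_succ) (by norm_num)
    (isSquareAt_four_mul_add_three.2 h)
  omega

/-- The word `xxyxyyxx` is a trimmed image of a square together with the letter in front of it. -/
theorem returnChain_eight_of_square_succ {m L : ℕ} (h : IsSquareAt (m + 1)) :
    ReturnChain (4 * m + 1) 8 L ↔ ∃ l, L = 4 * l ∧ ReturnChain (m + 1) 2 l := by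
  rw [returnChain_trim (s := 1) (e := 3) (l₀ := 3) (by norm_num) (by norm_num) (by norm_num) rfl]
  · constructor
    · rintro ⟨k, hk, hk'⟩
      obtain ⟨l, hl, hl'⟩ := (returnChain_pad (a := 1) (b := 0) le_rfl (by norm_num) h).1 hk'
      exact ⟨l, by omega, hl'⟩
    · rintro ⟨l, hl, hl'⟩
      exact ⟨l + 1, by omega, (returnChain_pad (a := 1) (b := 0) le_rfl (by norm_num) h).2
        ⟨l, rfl, hl'⟩⟩
  intro Q hQ
  have := hQ.mod_four_eq (i := 1) (j := 0) (by norm_num)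
    (isAlternatingAt_four_mul_add_two.2 h.not_of_succ) (by norm_num)
    (isSquareAt_four_mul_add_one m)
  omega

/-- The word `xyxyyxxyyxyx` is the image of a square together with its two neighbouring letters,
with two letters removed at either end. -/
theorem returnChain_twelve_of_square_succ {m L : ℕ} (h : IsSquareAt (m + 1)) :
    ReturnChain (4 * m + 2) 12 L ↔ ∃ l, L = 4 * l + 4 ∧ ReturnChain (m + 1) 2 l := by
  rw [returnChain_trim (s := 2) (e := 2) (l₀ := 4) (by norm_num) (by norm_num) (by norm_num) rfl]
  · constructor
    · rintro ⟨k, hk, hk'⟩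
      obtain ⟨l, hl, hl'⟩ := (returnChain_pad (a := 1) (b := 1) le_rfl le_rfl h).1 hk'
      exact ⟨l, by omega, hl'⟩
    · rintro ⟨l, hl, hl'⟩
      exact ⟨l + 2, by omega, (returnChain_pad (a := 1) (b := 1) le_rfl le_rfl h).2
        ⟨l, rfl, hl'⟩⟩
  intro Q hQ
  have := hQ.mod_four_eq (i := 0) (j := 3) (by norm_num)
    (isAlternatingAt_four_mul_add_two.2 h.not_of_succ) (by norm_num)
    (isSquareAt_four_mul_add_one (m + 1))
  omega

/-- The word `xyxxyyxxyx` is the image of a square together with its two neighbouring letters, with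
three letters removed at either end. -/
theorem returnChain_ten_of_square_succ {m L : ℕ} (h : IsSquareAt (m + 1)) :
    ReturnChain (4 * m + 3) 10 L ↔ ∃ l, L = 4 * l + 2 ∧ ReturnChain (m + 1) 2 l := by
  rw [returnChain_trim (s := 3) (e := 3) (l₀ := 4) (by norm_num) (by norm_num) (by norm_num) rfl]
  · constructor
    · rintro ⟨k, hk, hk'⟩
      obtain ⟨l, hl, hl'⟩ := (returnChain_pad (a := 1) (b := 1) le_rfl le_rfl h).1 hk'
      exact ⟨l, by omega, hl'⟩
    · rintro ⟨l, hl, hl'⟩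
      exact ⟨l + 2, by omega, (returnChain_pad (a := 1) (b := 1) le_rfl le_rfl h).2
        ⟨l, rfl, hl'⟩⟩
  intro Q hQ
  have := hQ.mod_four_eq (i := 0) (j := 2) (by norm_num)
    (isAlternatingAt_four_mul_add_three.2 h.not_of_succ) (by norm_num)
    (isSquareAt_four_mul_add_one (m + 1))
  omega

/-! ### The recursion for the lengths -/

/-- The lengths of the words reached by iterated complete first returns from a square `xx`. -/
def squareLengths : Set ℕ := {l | ∃ p, IsSquareAt p ∧ ReturnChain p 2 l}

/-- The lengths of the words reached by iterated complete first returns from an alternating word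
`xyx`. -/
def alternatingLengths : Set ℕ := {l | ∃ p, IsAlternatingAt p ∧ ReturnChain p 3 l}

/-- The recursion for the lengths reached from squares: the first return is the image of a square
trimmed by one letter at either end, the image of a square shifted by three letters, or the image of
an alternating word trimmed by one letter at either end. -/
theorem mem_squareLengths_iff {L : ℕ} : L ∈ squareLengths ↔ L = 2 ∨
    (∃ l ∈ squareLengths, L + 2 = 4 * l) ∨ (∃ l ∈ squareLengths, L = 4 * l) ∨
    ∃ l ∈ alternatingLengths, L + 2 = 4 * l := by
  constructor
  · rintro ⟨p, hp, hL⟩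
    obtain rfl | ⟨d, hd, hL⟩ := hL.eq_or_exists
    · exact .inl rfl
    right
    have hodd := odd_of_thueMorse_eq_succ hp
    obtain h | h : p % 4 = 1 ∨ p % 4 = 3 := by omega
    · obtain ⟨m, rfl⟩ : ∃ m, p = 4 * m + 1 := ⟨p / 4, by omega⟩
      by_cases h0 : IsSquareAt m
      · obtain rfl := hd.unique (isReturn_of_square h0).1
        obtain ⟨l, hl, hl'⟩ := (returnChain_six_of_square h0).1 hL
        exact .inl ⟨l, ⟨m, h0, hl'⟩, hl⟩
      by_cases h1 : IsSquareAt (m + 1)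
      · obtain rfl := hd.unique (isReturn_of_square_succ h1).1
        obtain ⟨l, hl, hl'⟩ := (returnChain_eight_of_square_succ h1).1 hL
        exact .inr (.inl ⟨l, ⟨m + 1, h1, hl'⟩, hl⟩)
      · obtain rfl := hd.unique (isReturn_of_alternating ⟨h0, h1⟩).1
        obtain ⟨l, hl, hl'⟩ := (returnChain_ten_of_alternating ⟨h0, h1⟩).1 hL
        exact .inr (.inr ⟨l, ⟨m, ⟨h0, h1⟩, hl'⟩, hl⟩)
    · obtain ⟨m, rfl⟩ : ∃ m, p = 4 * m + 3 := ⟨p / 4, by omega⟩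
      have h0 := isSquareAt_four_mul_add_three.1 hp
      obtain rfl := hd.unique (isReturn_of_square h0).2
      obtain ⟨l, hl, hl'⟩ := (returnChain_eight_of_square h0).1 hL
      exact .inr (.inl ⟨l, ⟨m, h0, hl'⟩, hl⟩)
  · rintro (rfl | ⟨l, ⟨m, hm, hl⟩, h⟩ | ⟨l, ⟨m, hm, hl⟩, h⟩ | ⟨l, ⟨m, hm, hl⟩, h⟩)
    · exact ⟨4 * 0 + 1, isSquareAt_four_mul_add_one 0, .refl⟩
    · exact ⟨4 * m + 1, isSquareAt_four_mul_add_one m,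
        .head (isReturn_of_square hm).1 ((returnChain_six_of_square hm).2 ⟨l, h, hl⟩)⟩
    · exact ⟨4 * m + 3, isSquareAt_four_mul_add_three.2 hm,
        .head (isReturn_of_square hm).2 ((returnChain_eight_of_square hm).2 ⟨l, h, hl⟩)⟩
    · exact ⟨4 * m + 1, isSquareAt_four_mul_add_one m,
        .head (isReturn_of_alternating hm).1 ((returnChain_ten_of_alternating hm).2 ⟨l, h, hl⟩)⟩

/-- The recursion for the lengths reached from alternating words: the first return is the image of
an alternating word trimmed by three or by two letters at either end, or the image of a square
extended by two letters or by one letter at either end. -/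
theorem mem_alternatingLengths_iff {L : ℕ} : L ∈ alternatingLengths ↔ L = 3 ∨
    (∃ l ∈ alternatingLengths, L + 6 = 4 * l) ∨ (∃ l ∈ alternatingLengths, L + 4 = 4 * l) ∨
    (∃ l ∈ squareLengths, L = 4 * l + 4) ∨ ∃ l ∈ squareLengths, L = 4 * l + 2 := by
  constructor
  · rintro ⟨p, hp, hL⟩
    obtain rfl | ⟨d, hd, hL⟩ := hL.eq_or_exists
    · exact .inl rfl
    right
    obtain h | h := hp.mod_four
    · obtain ⟨m, rfl⟩ : ∃ m, p = 4 * m + 2 := ⟨p / 4, by omega⟩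
      have h0 := isAlternatingAt_four_mul_add_two.1 hp
      by_cases h1 : IsSquareAt (m + 1)
      · obtain rfl := hd.unique (isReturn_of_square_succ h1).2.1
        obtain ⟨l, hl, hl'⟩ := (returnChain_twelve_of_square_succ h1).1 hL
        exact .inr (.inr (.inl ⟨l, ⟨m + 1, h1, hl'⟩, hl⟩))
      · obtain rfl := hd.unique (isReturn_of_alternating ⟨h0, h1⟩).2.2
        obtain ⟨l, hl, hl'⟩ := (returnChain_eight_of_alternating ⟨h0, h1⟩).1 hL
        exact .inr (.inl ⟨l, ⟨m, ⟨h0, h1⟩, hl'⟩, hl⟩)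
    · obtain ⟨m, rfl⟩ : ∃ m, p = 4 * m + 3 := ⟨p / 4, by omega⟩
      have h0 := isAlternatingAt_four_mul_add_three.1 hp
      by_cases h1 : IsSquareAt (m + 1)
      · obtain rfl := hd.unique (isReturn_of_square_succ h1).2.2
        obtain ⟨l, hl, hl'⟩ := (returnChain_ten_of_square_succ h1).1 hL
        exact .inr (.inr (.inr ⟨l, ⟨m + 1, h1, hl'⟩, hl⟩))
      · obtain rfl := hd.unique (isReturn_of_alternating ⟨h0, h1⟩).2.1
        obtain ⟨l, hl, hl'⟩ := (returnChain_six_of_alternating ⟨h0, h1⟩).1 hL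
        exact .inl ⟨l, ⟨m, ⟨h0, h1⟩, hl'⟩, hl⟩
  · -- a square never starts at position `0`, so that there is a letter in front of it
    have hpred : ∀ m, IsSquareAt m → ∃ k, m = k + 1 ∧ ¬IsSquareAt k := by
      intro m hm
      have := odd_of_thueMorse_eq_succ hm
      obtain ⟨k, rfl⟩ : ∃ k, m = k + 1 := ⟨m - 1, by omega⟩
      exact ⟨k, rfl, fun h => by have := odd_of_thueMorse_eq_succ h; omega⟩
    rintro (rfl | ⟨l, ⟨m, hm, hl⟩, h⟩ | ⟨l, ⟨m, hm, hl⟩, h⟩ | ⟨l, ⟨m, hm, hl⟩, h⟩ |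
      ⟨l, ⟨m, hm, hl⟩, h⟩)
    · exact ⟨4 * 0 + 2, isAlternatingAt_four_mul_add_two.2
        fun h => by have := odd_of_thueMorse_eq_succ h; omega, .refl⟩
    · exact ⟨4 * m + 3, isAlternatingAt_four_mul_add_three.2 hm.1,
        .head (isReturn_of_alternating hm).2.1 ((returnChain_six_of_alternating hm).2 ⟨l, h, hl⟩)⟩
    · exact ⟨4 * m + 2, isAlternatingAt_four_mul_add_two.2 hm.1,
        .head (isReturn_of_alternating hm).2.2
          ((returnChain_eight_of_alternating hm).2 ⟨l, h, hl⟩)⟩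
    · obtain ⟨k, rfl, hk⟩ := hpred m hm
      exact ⟨4 * k + 2, isAlternatingAt_four_mul_add_two.2 hk,
        .head (isReturn_of_square_succ hm).2.1
          ((returnChain_twelve_of_square_succ hm).2 ⟨l, h, hl⟩)⟩
    · obtain ⟨k, rfl, hk⟩ := hpred m hm
      exact ⟨4 * k + 3, isAlternatingAt_four_mul_add_three.2 hk,
        .head (isReturn_of_square_succ hm).2.2
          ((returnChain_ten_of_square_succ hm).2 ⟨l, h, hl⟩)⟩

/-! ### Gaps in the lengths -/

theorem two_le_of_mem_squareLengths {l : ℕ} (h : l ∈ squareLengths) : 2 ≤ l := by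
  obtain ⟨p, -, h⟩ := h
  exact h.le

theorem three_le_of_mem_alternatingLengths {l : ℕ} (h : l ∈ alternatingLengths) : 3 ≤ l := by
  obtain ⟨p, -, h⟩ := h
  exact h.le

theorem gapSeq_succ {n : ℕ} (hn : 1 ≤ n) :
    gapSeq (n + 1) = 4 * (gapSeq n - 2) - 2 * (-1) ^ n := by
  obtain ⟨n, rfl⟩ : ∃ k, n = k + 1 := ⟨n - 1, by omega⟩
  rw [gapSeq, pow_succ _ (n + 1)]
  ring

theorem fourteen_le_gapSeq {n : ℕ} (hn : 1 ≤ n) : 14 ≤ gapSeq n := by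
  induction n, hn using Nat.le_induction with
  | base => simp [gapSeq]
  | succ n hn ih =>
    rw [gapSeq_succ hn]
    rcases neg_one_pow_eq_or ℤ n with e | e <;> rw [e] <;> omega

/-- The gaps in the two sets of lengths. The bounds are not attained for every `n`; they are
chosen so that the recursion preserves the two inequalities jointly. -/
theorem lengths_le_of_lt {n : ℕ} (hn : 1 ≤ n) :
    (∀ l ∈ squareLengths, l < 2 ^ (2 * (n + 1)) + 6 → (l : ℤ) ≤ gapSeq n - 4) ∧
    ∀ l ∈ alternatingLengths, l < 2 ^ (2 * (n + 1)) + 2 →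
      (l : ℤ) ≤ gapSeq n - 4 - 2 * (-1) ^ n := by
  induction n, hn using Nat.le_induction with
  | base =>
    -- the same statement one level down, with `6` in place of both thresholds
    have hS : ∀ l ∈ squareLengths, l < 6 → l = 2 := by
      intro l hl hlt
      rcases mem_squareLengths_iff.1 hl with h | ⟨k, hk, h⟩ | ⟨k, hk, h⟩ | ⟨k, hk, h⟩
      · exact h
      · have := two_le_of_mem_squareLengths hk
        omega
      · have := two_le_of_mem_squareLengths hk
        omega
      · have := three_le_of_mem_alternatingLengths hk
        omega
    have hT : ∀ l ∈ alternatingLengths, l < 6 → l = 3 := by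
      intro l hl hlt
      rcases mem_alternatingLengths_iff.1 hl with h | ⟨k, hk, h⟩ | ⟨k, hk, h⟩ | ⟨k, hk, h⟩ |
        ⟨k, hk, h⟩
      · exact h
      · have := three_le_of_mem_alternatingLengths hk
        omega
      · have := three_le_of_mem_alternatingLengths hk
        omega
      · have := two_le_of_mem_squareLengths hk
        omega
      · have := two_le_of_mem_squareLengths hk
        omega
    norm_num [gapSeq]
    constructor
    · intro l hl hlt
      rcases mem_squareLengths_iff.1 hl with h | ⟨k, hk, h⟩ | ⟨k, hk, h⟩ | ⟨k, hk, h⟩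
      · omega
      · have := hS k hk (by omega)
        omega
      · have := hS k hk (by omega)
        omega
      · have := hT k hk (by omega)
        omega
    · intro l hl hlt
      rcases mem_alternatingLengths_iff.1 hl with h | ⟨k, hk, h⟩ | ⟨k, hk, h⟩ | ⟨k, hk, h⟩ |
        ⟨k, hk, h⟩
      · omega
      · have := hT k hk (by omega)
        omega
      · have := hT k hk (by omega)
        omega
      · have := hS k hk (by omega)
        omega
      · have := hS k hk (by omega)
        omega
  | succ n hn ih =>
    obtain ⟨hS, hT⟩ := ih
    rw [gapSeq_succ hn, pow_succ (-1 : ℤ) n,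
      show 2 ^ (2 * (n + 1 + 1)) = 4 * 2 ^ (2 * (n + 1)) by ring]
    have h14 := fourteen_le_gapSeq hn
    generalize 2 ^ (2 * (n + 1)) = M at *
    constructor
    · intro l hl hlt
      rcases mem_squareLengths_iff.1 hl with h | ⟨k, hk, h⟩ | ⟨k, hk, h⟩ | ⟨k, hk, h⟩
      · rcases neg_one_pow_eq_or ℤ n with e | e <;> rw [e] <;> omega
      · have := hS k hk (by omega)
        rcases neg_one_pow_eq_or ℤ n with e | e <;> rw [e] <;> omega
      · have := hS k hk (by omega)
        rcases neg_one_pow_eq_or ℤ n with e | e <;> rw [e] <;> omega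
      · have := hT k hk (by omega)
        rcases neg_one_pow_eq_or ℤ n with e | e <;> rw [e] at this ⊢ <;> omega
    · intro l hl hlt
      rcases mem_alternatingLengths_iff.1 hl with h | ⟨k, hk, h⟩ | ⟨k, hk, h⟩ | ⟨k, hk, h⟩ |
        ⟨k, hk, h⟩
      · rcases neg_one_pow_eq_or ℤ n with e | e <;> rw [e] <;> omega
      · have := hT k hk (by omega)
        rcases neg_one_pow_eq_or ℤ n with e | e <;> rw [e] at this ⊢ <;> omega
      · have := hT k hk (by omega)
        rcases neg_one_pow_eq_or ℤ n with e | e <;> rw [e] at this ⊢ <;> omega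
      · have := hS k hk (by omega)
        rcases neg_one_pow_eq_or ℤ n with e | e <;> rw [e] <;> omega
      · have := hS k hk (by omega)
        rcases neg_one_pow_eq_or ℤ n with e | e <;> rw [e] <;> omega

theorem gapSeq_le {n : ℕ} (hn : 1 ≤ n) : gapSeq n ≤ 3 * 4 ^ n + 2 := by
  induction n, hn using Nat.le_induction with
  | base => simp [gapSeq]
  | succ n hn ih =>
    rw [gapSeq_succ hn, pow_succ (4 : ℤ) n]
    rcases neg_one_pow_eq_or ℤ n with e | e <;> rw [e] <;> omega

/-- The lower end of the gap is attained, alternately by an alternating word and by a square padded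
with one letter on either side. -/
theorem exists_length_eq_gapSeq_sub {n : ℕ} (hn : 1 ≤ n) :
    ((-1 : ℤ) ^ n = -1 ∧ ∃ l ∈ alternatingLengths, (l : ℤ) = gapSeq n - 2) ∨
    ((-1 : ℤ) ^ n = 1 ∧ ∃ l ∈ squareLengths, (l : ℤ) = gapSeq n - 4) := by
  induction n, hn using Nat.le_induction with
  | base =>
    have h2 : 2 ∈ squareLengths := mem_squareLengths_iff.2 (.inl rfl)
    have h12 : 12 ∈ alternatingLengths :=
      mem_alternatingLengths_iff.2 (.inr (.inr (.inr (.inl ⟨2, h2, rfl⟩))))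
    exact .inl ⟨by norm_num, 12, h12, by norm_num [gapSeq]⟩
  | succ n hn ih =>
    rw [gapSeq_succ hn, pow_succ]
    rcases ih with ⟨e, l, hl, h⟩ | ⟨e, l, hl, h⟩
    · have := three_le_of_mem_alternatingLengths hl
      exact .inr ⟨by rw [e]; norm_num, 4 * l - 2,
        mem_squareLengths_iff.2 (.inr (.inr (.inr ⟨l, hl, by omega⟩))), by rw [e]; omega⟩
    · exact .inl ⟨by rw [e]; norm_num, 4 * l + 4,
        mem_alternatingLengths_iff.2 (.inr (.inr (.inr (.inl ⟨l, hl, rfl⟩)))), by rw [e]; omega⟩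

theorem two_pow_odd_mem_squareLengths (n : ℕ) : 2 ^ (2 * n + 1) ∈ squareLengths := by
  induction n with
  | zero => exact mem_squareLengths_iff.2 (.inl rfl)
  | succ n ih => exact mem_squareLengths_iff.2 (.inr (.inr (.inl ⟨_, ih, by ring⟩)))

theorem two_pow_even_add_two_mem_alternatingLengths (n : ℕ) :
    2 ^ (2 * (n + 1)) + 2 ∈ alternatingLengths := by
  induction n with
  | zero =>
    exact mem_alternatingLengths_iff.2
      (.inr (.inl ⟨3, mem_alternatingLengths_iff.2 (.inl rfl), rfl⟩))
  | succ n ih => exact mem_alternatingLengths_iff.2 (.inr (.inl ⟨_, ih, by ring⟩))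

/-! ### Privileged factors and chains -/

theorem factorEq_iff_map_range_eq {l p q : ℕ} : FactorEq l p q ↔
    (List.range l).map (fun j => thueMorse (p + j)) =
      (List.range l).map (fun j => thueMorse (q + j)) := by
  simp [FactorEq]

theorem map_range_thueMorse_add (p a b : ℕ) :
    (List.range (a + b)).map (fun j => thueMorse (p + j)) =
      (List.range a).map (fun j => thueMorse (p + j)) ++
        (List.range b).map (fun j => thueMorse (p + a + j)) := by
  simp [List.range_add, add_assoc]

theorem occursAt_map_range_iff {p l n i : ℕ} :
    OccursAt ((List.range l).map fun j => thueMorse (p + j))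
      ((List.range n).map fun j => thueMorse (p + j)) i ↔
      i + l ≤ n ∧ FactorEq l p (p + i) := by
  constructor
  · rintro ⟨z, v, hw, rfl⟩
    have hlen := congrArg List.length hw
    simp only [List.length_map, List.length_range, List.length_append] at hlen
    refine ⟨by omega, factorEq_iff_map_range_eq.2 ?_⟩
    rw [hlen, map_range_thueMorse_add, map_range_thueMorse_add] at hw
    exact (List.append_inj (List.append_inj hw (by simp)).1 (by simp)).2.symm
  · rintro ⟨hn, h⟩
    obtain ⟨m, rfl⟩ := Nat.exists_eq_add_of_le hn
    refine ⟨(List.range i).map fun j => thueMorse (p + j),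
      (List.range m).map fun j => thueMorse (p + (i + l) + j), ?_, by simp⟩
    rw [map_range_thueMorse_add, map_range_thueMorse_add, factorEq_iff_map_range_eq.1 h]

theorem isReturn_iff_isCompleteFirstReturn {p l d : ℕ} (hd : 0 < d) :
    IsReturn p l d ↔ IsCompleteFirstReturn ((List.range l).map fun j => thueMorse (p + j))
      ((List.range (l + d)).map fun j => thueMorse (p + j)) := by
  have h0 : FactorEq l p (p + 0) := fun i _ => rfl
  constructor
  · rintro ⟨-, h2, h3⟩
    refine ⟨?_, ?_, ?_⟩
    · rw [map_range_thueMorse_add]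
      exact List.prefix_append _ _
    · rw [add_comm l d, map_range_thueMorse_add, factorEq_iff_map_range_eq.1 h2]
      exact List.suffix_append _ _
    · rw [show {i | OccursAt _ _ i} = {0, d} from ?_, Set.ncard_pair hd.ne]
      ext i
      simp only [Set.mem_ofPred_eq, occursAt_map_range_iff, Set.mem_insert_iff,
        Set.mem_singleton_iff]
      constructor
      · rintro ⟨hi, h⟩
        by_contra! hne
        exact h3 i (by omega) (by omega) h
      · rintro (rfl | rfl)
        · exact ⟨by omega, h0⟩
        · exact ⟨by omega, h2⟩
  · rintro ⟨-, ⟨z, hz⟩, hcard⟩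
    have hzl : z.length = d := by
      have := congrArg List.length hz
      simp only [List.length_map, List.length_range, List.length_append] at this
      omega
    have hd' : OccursAt ((List.range l).map fun j => thueMorse (p + j))
      ((List.range (l + d)).map fun j => thueMorse (p + j)) d := ⟨z, [], by simp [hz], hzl⟩
    have hfin := Set.finite_of_ncard_ne_zero (by rw [hcard]; norm_num)
    have heq := Set.eq_of_subset_of_ncard_le (s := {0, d})
      (Set.insert_subset (occursAt_map_range_iff.2 ⟨by omega, h0⟩)
        (Set.singleton_subset_iff.2 hd')) (by rw [hcard, Set.ncard_pair hd.ne]) hfin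
    refine ⟨hd, (occursAt_map_range_iff.1 hd').2, fun e he hed h => ?_⟩
    have : e ∈ ({0, d} : Set ℕ) := heq ▸ occursAt_map_range_iff.2 ⟨by omega, h⟩
    simp only [Set.mem_insert_iff, Set.mem_singleton_iff] at this
    omega

theorem IsPrivileged.returnChain {u : List (Fin 2)} (hu : IsPrivileged u) : ∀ p,
    u = (List.range u.length).map (fun j => thueMorse (p + j)) → u ≠ [] →
    ReturnChain p 1 u.length := by
  induction hu with
  | empty => exact fun _ _ h => absurd rfl h
  | letter a => exact fun _ _ _ => .refl
  | completeReturn v u hv hlen hret ih =>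
    intro p hp _
    obtain ⟨d, hd⟩ := Nat.exists_eq_add_of_lt hlen
    have hvp : v = (List.range v.length).map (fun j => thueMorse (p + j)) := by
      obtain ⟨z, hz⟩ := hret.1
      rw [← hz, List.length_append, map_range_thueMorse_add] at hp
      exact (List.append_inj hp (by simp)).1
    rw [add_assoc] at hd
    have hr : IsReturn p v.length (d + 1) := by
      rw [isReturn_iff_isCompleteFirstReturn (by omega), ← hd, ← hp, ← hvp]
      exact hret
    rcases eq_or_ne v [] with rfl | hne
    · -- the empty word returns immediately, so that its complete first return is a letter
      have hd0 : d = 0 := by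
        by_contra h0
        exact hr.2.2 1 one_pos (by omega) (by simp [FactorEq])
      rw [hd, hd0]
      exact .refl
    · rw [hd]
      exact (ih p hvp hne).step hr

theorem ReturnChain.isPrivileged {p l : ℕ} (h : ReturnChain p 1 l) :
    IsPrivileged ((List.range l).map fun j => thueMorse (p + j)) := by
  induction h with
  | refl => exact .letter _
  | @step l d h hd ih =>
    have := hd.1
    exact .completeReturn _ _ ih (by simpa) ((isReturn_iff_isCompleteFirstReturn this).1 hd)

theorem privilegedComplexity_thueMorse_ne_zero_iff {n : ℕ} (hn : 0 < n) :
    privilegedComplexity thueMorse n ≠ 0 ↔ ∃ p, ReturnChain p 1 n := by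
  rw [privilegedComplexity, ← Nat.pos_iff_ne_zero,
    Set.ncard_pos (privilegedFactors_finite _ _)]
  constructor
  · rintro ⟨u, hu, ⟨p, hp⟩, rfl⟩
    exact ⟨p, hu.returnChain p hp (List.length_pos_iff.1 hn)⟩
  · rintro ⟨p, h⟩
    exact ⟨_, h.isPrivileged, ⟨p, by simp⟩, by simp⟩

/-- The return to a letter: it is found at distance `1`, `2` or `3`. -/
theorem isReturn_one {p : ℕ} :
    (IsSquareAt p → IsReturn p 1 1) ∧ (IsAlternatingAt p → IsReturn p 1 2) ∧
      (IsSquareAt (p + 1) → IsReturn p 1 3) := by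
  have hc := thueMorse_not_cube p
  have hc' := thueMorse_not_cube (p + 1)
  simp only [isReturn_iff_fin, IsSquareAt, IsAlternatingAt, Fin.forall_fin_succ,
    Fin.forall_fin_zero]
  simp [add_assoc] at hc hc' ⊢
  generalize thueMorse p = a at *
  generalize thueMorse (p + 1) = b at *
  generalize thueMorse (p + 2) = c at *
  generalize thueMorse (p + 3) = d at *
  constructor
  · clear hc hc'
    decide +revert
  · decide +revert

/-! ### The privileged complexity function -/

theorem exists_returnChain_one_iff {n : ℕ} : (∃ p, ReturnChain p 1 n) ↔
    n = 1 ∨ n ∈ squareLengths ∨ n ∈ alternatingLengths ∨ ∃ l ∈ squareLengths, n = l + 2 := by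
  constructor
  · rintro ⟨p, h⟩
    obtain rfl | ⟨d, hd, h⟩ := h.eq_or_exists
    · exact .inl rfl
    right
    by_cases h0 : IsSquareAt p
    · obtain rfl := hd.unique (isReturn_one.1 h0)
      exact .inl ⟨p, h0, h⟩
    by_cases h1 : IsSquareAt (p + 1)
    · obtain rfl := hd.unique (isReturn_one.2.2 h1)
      obtain ⟨l, hl, h⟩ := (returnChain_pad (a := 1) (b := 1) le_rfl le_rfl h1).1 h
      exact .inr (.inr ⟨l, ⟨p + 1, h1, h⟩, hl⟩)
    · obtain rfl := hd.unique (isReturn_one.2.1 ⟨h0, h1⟩)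
      exact .inr (.inl ⟨p, ⟨h0, h1⟩, h⟩)
  · rintro (rfl | ⟨p, hp, h⟩ | ⟨p, hp, h⟩ | ⟨l, ⟨p, hp, h⟩, rfl⟩)
    · exact ⟨0, .refl⟩
    · exact ⟨p, .head (isReturn_one.1 hp) h⟩
    · exact ⟨p, .head (isReturn_one.2.1 hp) h⟩
    · have := odd_of_thueMorse_eq_succ hp
      obtain ⟨k, rfl⟩ : ∃ k, p = k + 1 := ⟨p - 1, by omega⟩
      exact ⟨k, .head (isReturn_one.2.2 hp)
        ((returnChain_pad (a := 1) (b := 1) le_rfl le_rfl hp).2 ⟨l, rfl, h⟩)⟩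

theorem privilegedComplexity_thueMorse_eq_zero {n k : ℕ} (hn : 1 ≤ n)
    (hk : gapSeq n - 1 ≤ (k : ℤ)) (hk' : k ≤ 2 ^ (2 * (n + 1)) + 1) :
    privilegedComplexity thueMorse k = 0 := by
  have h14 := fourteen_le_gapSeq hn
  obtain ⟨hS, hT⟩ := lengths_le_of_lt hn
  by_contra h
  rw [← ne_eq, privilegedComplexity_thueMorse_ne_zero_iff (by omega),
    exists_returnChain_one_iff] at h
  rcases h with rfl | h | h | ⟨l, h, rfl⟩
  · omega
  · have := hS k h (by omega)
    omega
  · have := hT k h (by omega)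
    rcases neg_one_pow_eq_or ℤ n with e | e <;> rw [e] at this <;> omega
  · have := hS l h (by omega)
    omega

theorem mainTheorem3 :
    (∀ n : ℕ, 1 ≤ n →
      (∀ k : ℕ, gapSeq n - 1 ≤ (k : ℤ) → k ≤ 2 ^ (2 * (n + 1)) + 1 →
        privilegedComplexity thueMorse k = 0) ∧
      (∃ m : ℕ, (m : ℤ) = gapSeq n - 2 ∧ privilegedComplexity thueMorse m ≠ 0) ∧
      privilegedComplexity thueMorse (2 ^ (2 * n + 1) + 2) ≠ 0 ∧
      privilegedComplexity thueMorse (2 ^ (2 * (n + 1)) + 2) ≠ 0) ∧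
    (∀ L : ℕ, ∃ m : ℕ, ∀ k : ℕ, m ≤ k → k < m + L → privilegedComplexity thueMorse k = 0) ∧
    (∀ N : ℕ, ∃ k : ℕ, N ≤ k ∧ privilegedComplexity thueMorse k ≠ 0) := by
  have hne : ∀ k, 0 < k → (k ∈ squareLengths ∨ k ∈ alternatingLengths ∨
      ∃ l ∈ squareLengths, k = l + 2) → privilegedComplexity thueMorse k ≠ 0 := fun k hk h =>
    (privilegedComplexity_thueMorse_ne_zero_iff hk).2 (exists_returnChain_one_iff.2 (.inr h))
  have heven : ∀ n, privilegedComplexity thueMorse (2 ^ (2 * (n + 1)) + 2) ≠ 0 := fun n =>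
    hne _ (Nat.succ_pos _) (.inr (.inl (two_pow_even_add_two_mem_alternatingLengths n)))
  refine ⟨fun n hn => ⟨fun k => privilegedComplexity_thueMorse_eq_zero hn, ?_,
    hne _ (Nat.succ_pos _) (.inr (.inr ⟨_, two_pow_odd_mem_squareLengths n, rfl⟩)), heven n⟩,
    ?_, ?_⟩
  · have h14 := fourteen_le_gapSeq hn
    rcases exists_length_eq_gapSeq_sub hn with ⟨-, l, hl, h⟩ | ⟨-, l, hl, h⟩
    · exact ⟨l, h, hne l (by omega) (.inr (.inl hl))⟩
    · exact ⟨l + 2, by push_cast; omega, hne _ (Nat.succ_pos _) (.inr (.inr ⟨l, hl, rfl⟩))⟩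
  · intro L
    refine ⟨3 * 4 ^ (L + 1) + 1, fun k hk hkL =>
      privilegedComplexity_thueMorse_eq_zero (n := L + 1) (by omega) ?_ ?_⟩
    · have h := gapSeq_le (n := L + 1) (by omega)
      zify at hk
      linarith
    · have h : L + 1 < 4 ^ (L + 1) := Nat.lt_pow_self (by norm_num)
      rw [pow_mul, pow_succ (2 ^ 2) (L + 1)]
      norm_num
      omega
  · intro N
    have h : 2 * (N + 1) < 2 ^ (2 * (N + 1)) := Nat.lt_two_pow_self
    exact ⟨2 ^ (2 * (N + 1)) + 2, by omega, heven N⟩
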